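/- Let $\ell$ be an odd prime and let $T$ be a nonzero integer with $\ell\mid T$. For $m\ge 1$ let $$G(m)=\{(g_1,g_2)\in \mathrm{GL}_2(\mathbb Z/m\mathbb Z)^2:\ \det g_1=\det g_2\},\qquad G(m,T)=\{(g_1,g_2)\in G(m):\ \operatorname{tr} g_1+\operatorname{tr} g_2\equiv T \bmod m\}.$$ Let $v=v_\ell(T)\ge 1$ be the $\ell$-adic valuation of $T$, let $e=e_\ell(T)=\lfloor (v-1)/2\rfloor$, let $\delta_2(v)=1$ if $v$ is even and $\delta_2(v)=0$ if $v$ is odd, and put $$E(\ell,T)=\frac{2\ell^3(\ell+1)(\ell^{4e+4}-1)+\ell^3(\ell^4+\ell^3+2\ell^2-\ell-1)(\ell^{4e}-1)}{(\ell^2+1)(\ell+1)},$$ a rational number whose denominator in lowest terms is prime to $\ell$. Then: 1. For every $n\ge v+1$, $$|G(\ell^n,T)|=(\ell-1)\,\ell^{6n-4e-9}\Bigl(\ell^{4e+3}(\ell^5-\ell^3-3\ell^2+1)+E(\ell,T)+\ell\,\delta_2(v)(\ell^3-1)\Bigr).$$ 2. $$\lim_{n\to\infty}\frac{\ell^n\,|G(\ell^n,T)|}{|G(\ell^n)|}=\frac{\ell^6-\ell^4-3\ell^3+\ell}{\ell^6-2\ell^4+\ell^2}+\frac{E(\ell,T)+\ell\,\delta_2(v)(\ell^3-1)}{\ell^{4e+4}(\ell^2-1)^2}.$$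 -/

import Mathlib

open Filter Topology

/-- The group `(GL₂ ×_det GL₂)(R)` of pairs of invertible matrices with equal determinants. -/
def GLTwoDet (R : Type*) [CommRing R] : Subgroup (GL (Fin 2) R × GL (Fin 2) R) where
  carrier := {g | g.1.val.det = g.2.val.det}
  one_mem' := rfl
  mul_mem' := by
    intro a b ha hb
    simp only [Set.mem_setOf_eq] at ha hb ⊢
    simp [Matrix.det_mul, ha, hb]
  inv_mem' := by
    intro a ha
    simp only [Set.mem_setOf_eq] at ha ⊢
    simp [Matrix.coe_units_inv, Matrix.det_nonsing_inv, ha]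

/-- `G(m) = (GL₂ ×_det GL₂)(ℤ/mℤ)`. -/
abbrev GMod (m : ℕ) : Type := GLTwoDet (ZMod m)

/-- `G(m, T)`: the pairs in `G(m)` whose traces sum to `T` modulo `m`. -/
def GModTrace (m : ℕ) (T : ℤ) : Set (GMod m) :=
  {g | g.val.1.val.trace + g.val.2.val.trace = (T : ZMod m)}

/-- `e_ℓ(T) = ⌊(v_ℓ(T) - 1) / 2⌋`, used only when `v_ℓ(T) ≥ 1`. -/
def eFloor (l : ℕ) (T : ℤ) : ℕ := (padicValInt l T - 1) / 2

/-- `δ_k(m)` is `1` if `k` divides `m`, and `0` otherwise. -/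
def deltaDvd (k m : ℕ) : ℕ := if k ∣ m then 1 else 0

/-- The quantity `E(ℓ, T)`. -/
def EQuot (l : ℕ) (T : ℤ) : ℚ :=
  (2 * (l : ℚ) ^ 3 * ((l : ℚ) + 1) * ((l : ℚ) ^ (4 * eFloor l T + 4) - 1)
    + (l : ℚ) ^ 3 * ((l : ℚ) ^ 4 + (l : ℚ) ^ 3 + 2 * (l : ℚ) ^ 2 - (l : ℚ) - 1)
      * ((l : ℚ) ^ (4 * eFloor l T) - 1))
  / (((l : ℚ) ^ 2 + 1) * ((l : ℚ) + 1))

/-! ### Values of `x² + bc` and of the determinant over a finite local ring. -/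

section LocalCounting

/-! Write Q(x, b, c) = x² + bc. Since 2 is invertible, a matrix is its trace t together with its
doubled traceless part v, and 4 det = t² - Q(v). If the second matrix has trace T - t and traceless
part w, equality of determinants reads Q(w) = Q(v) + s with s = T(T - 2t), and invertibility says
that t² - Q(v) is a unit (`card_GModTrace`). As ℓ divides T, s is never a unit.

If ℓ ∣ t, then Q(v) must be a unit. The number of representations of a unit by Q depends only on its
quadratic character mod ℓ, and a character sum finishes (`card_pairs_unit`).

If ℓ ∤ t, then T - 2t is a unit and s has valuation exactly v_ℓ(T). All pairs with Q(w) - Q(v) = s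
are counted (`card_sq_add_mul_pairs`): this difference is a split form in six variables, i.e. a dot
product of two vectors in dimension 3, and the count stratifies by the content of one vector. The
pairs with Q(v) ≡ t², a nonzero square, are then removed (`card_pairs_square`).

Neither count depends on t beyond its class of cases, so summing over t gives a closed form in
v_ℓ(T). Its two parities give the stated formula; dividing by |G(ℓⁿ)| gives a ratio constant for n >
v_ℓ(T). -/

theorem isUnit_of_map_ne_zero {R k : Type*} [CommRing R] [Field k] (ρ : R →+* k) [IsLocalHom ρ]
    {x : R} (hx : ρ x ≠ 0) : IsUnit x :=
  isUnit_of_map_unit ρ x (isUnit_iff_ne_zero.2 hx)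

set_option linter.unusedSectionVars false

variable {R k : Type*} [CommRing R] [Fintype R] [DecidableEq R] [Field k] [Fintype k]
  [DecidableEq k] (ρ : R →+* k)

/-- All fibres of a surjective ring homomorphism have the size of its kernel. -/
theorem card_fiber_eq_card_ker (hρ : Function.Surjective ρ) (a : k) :
    (Finset.univ.filter fun x : R => ρ x = a).card
      = (Finset.univ.filter fun x : R => ρ x = 0).card := by
  obtain ⟨y, rfl⟩ := hρ a
  refine Finset.card_bij' (fun x _ => x - y) (fun x _ => x + y) ?_ ?_ ?_ ?_ <;>
    simp +contextual

theorem sum_comp_eq_card_ker_mul (hρ : Function.Surjective ρ) {A : Type*} [CommRing A]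
    (f : k → A) :
    ∑ x : R, f (ρ x) = (Finset.univ.filter fun x : R => ρ x = 0).card * ∑ a : k, f a := by
  rw [← Finset.sum_fiberwise (s := Finset.univ) (g := fun x : R => ρ x), Finset.mul_sum]
  refine Finset.sum_congr rfl fun a _ => ?_
  rw [← card_fiber_eq_card_ker ρ hρ a, ← nsmul_eq_mul]
  exact Finset.sum_eq_card_nsmul fun x hx => by rw [(Finset.mem_filter.1 hx).2]

theorem card_eq_card_ker_mul (hρ : Function.Surjective ρ) :
    (Fintype.card R : ℤ) = (Finset.univ.filter fun x : R => ρ x = 0).card * Fintype.card k := by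
  simpa using sum_comp_eq_card_ker_mul ρ hρ (A := ℤ) fun _ => 1

variable [IsLocalHom ρ]

/-- Square roots of a unit lift uniquely from the residue field. -/
theorem card_sqrt_eq_card_sqrt_map (hρ : Function.Surjective ρ) (h2 : (2 : k) ≠ 0) {D : R}
    (hD : ρ D ≠ 0) :
    (Finset.univ.filter fun x : R => x ^ 2 = D).card
      = (Finset.univ.filter fun y : k => y ^ 2 = ρ D).card := by
  have key : ∀ x y : R, ρ x ≠ 0 → ρ x = ρ y → x ^ 2 = y ^ 2 → x = y := by
    intro x y hx hxy h
    have hu : IsUnit (x + y) := isUnit_of_map_ne_zero ρ (by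
      rw [map_add, ← hxy, ← two_mul]; exact mul_ne_zero h2 hx)
    have : (x + y) * (x - y) = 0 := by linear_combination h
    exact sub_eq_zero.1 ((hu.mul_right_eq_zero).1 this)
  refine Finset.card_bij (fun x _ => ρ x) ?_ ?_ ?_
  · intro x hx
    simp only [Finset.mem_filter, Finset.mem_univ, true_and] at hx ⊢
    rw [← map_pow, hx]
  · intro x hx y hy hxy
    simp only [Finset.mem_filter, Finset.mem_univ, true_and] at hx hy
    refine key x y ?_ hxy (hx.trans hy.symm)
    rintro h0
    exact hD (by rw [← hx, map_pow, h0]; simp)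
  · intro y hy
    simp only [Finset.mem_filter, Finset.mem_univ, true_and] at hy
    have hy0 : y ≠ 0 := by rintro rfl; exact hD (by rw [← hy]; simp)
    -- Squaring maps the fibre over y injectively to the fibre over y²; both have the size of the
    -- kernel, so it is onto. This replaces Hensel's lemma.
    have hs := Finset.surjOn_of_injOn_of_card_le
      (s := Finset.univ.filter fun x : R => ρ x = y)
      (t := Finset.univ.filter fun x : R => ρ x = y ^ 2) (fun x => x ^ 2)
      (fun x hx => by simp at hx; simp [hx])
      (fun x hx z hz h => by
        simp at hx hz
        exact key x z (by rwa [hx]) (hx.trans hz.symm) h)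
      (by rw [card_fiber_eq_card_ker ρ hρ, card_fiber_eq_card_ker ρ hρ y])
    obtain ⟨x, hx, hxD⟩ := hs (show D ∈ _ by simp [hy])
    simp at hx
    exact ⟨x, by simpa using hxD, hx⟩

/-- Number of representations of a unit by `x² + bc` over a finite local ring. -/
theorem card_sq_add_mul_eq (hρ : Function.Surjective ρ) (h2 : (2 : k) ≠ 0) {D : R}
    (hD : ρ D ≠ 0) :
    ((Finset.univ.filter fun v : R × R × R => v.1 ^ 2 + v.2.1 * v.2.2 = D).card : ℤ)
      = ((Finset.univ.filter fun x : R => ρ x = 0).card : ℤ) ^ 2 * Fintype.card k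
        * (Fintype.card k + quadraticChar k (ρ D)) := by
  have hk : ringChar k ≠ 2 := by
    intro h
    apply h2
    have := ringChar.Nat.cast_ringChar (R := k)
    rw [h] at this
    exact_mod_cast this
  -- If b is a unit, x determines c. Otherwise D - bc keeps the residue of D, so each c admits 1 +
  -- χ(D) square roots.
  have hb : ∀ b : R, (∑ c : R, ∑ x : R, if x ^ 2 + b * c = D then (1 : ℤ) else 0)
      = if ρ b = 0 then (Fintype.card R : ℤ) * (quadraticChar k (ρ D) + 1)
        else Fintype.card R := by
    intro b
    split_ifs with h
    · have hc : ∀ c : R, (∑ x : R, if x ^ 2 + b * c = D then (1 : ℤ) else 0)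
          = quadraticChar k (ρ D) + 1 := by
        intro c
        have hDc : ρ (D - b * c) = ρ D := by simp [h]
        rw [← hDc, ← quadraticChar_card_sqrts hk, Finset.sum_boole]
        have := card_sqrt_eq_card_sqrt_map ρ hρ h2 (D := D - b * c) (by rwa [hDc])
        simp only [eq_sub_iff_add_eq] at this
        rw [this]
        congr 2
        ext; simp [eq_sub_iff_add_eq]
      simp [hc]
    · obtain ⟨u, rfl⟩ := isUnit_of_map_ne_zero ρ h
      rw [Finset.sum_comm]
      have hx : ∀ x : R, (∑ c : R, if x ^ 2 + u * c = D then (1 : ℤ) else 0) = 1 := by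
        intro x
        have : ∀ c : R, x ^ 2 + u * c = D ↔ c = ↑u⁻¹ * (D - x ^ 2) := by
          intro c
          rw [Units.eq_inv_mul_iff_mul_eq, eq_sub_iff_add_eq, add_comm]
        simp [this]
      simp [hx]
  have : ((Finset.univ.filter fun v : R × R × R => v.1 ^ 2 + v.2.1 * v.2.2 = D).card : ℤ)
      = ∑ b : R, ∑ c : R, ∑ x : R, if x ^ 2 + b * c = D then (1 : ℤ) else 0 := by
    rw [Finset.card_filter, Nat.cast_sum, Fintype.sum_prod_type_right, Fintype.sum_prod_type]
    simp
  rw [this, Finset.sum_congr rfl fun b _ => hb b]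
  rw [sum_comp_eq_card_ker_mul ρ hρ (A := ℤ) fun a => if a = 0 then
    (Fintype.card R : ℤ) * (quadraticChar k (ρ D) + 1) else Fintype.card R,
    card_eq_card_ker_mul ρ hρ, Finset.sum_ite, Finset.sum_const, Finset.sum_const,
    Finset.filter_ne', Finset.card_erase_of_mem (Finset.mem_univ _), Finset.card_univ,
    Finset.filter_eq']
  have h1 : 1 ≤ Fintype.card k := Fintype.card_pos
  simp only [Finset.mem_univ, if_true, Finset.card_singleton, nsmul_eq_mul]
  push_cast [h1]
  ring

/-- Number of matrices with a given unit determinant over a finite local ring. -/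
theorem card_det_eq (hρ : Function.Surjective ρ) {D : R} (hD : ρ D ≠ 0) :
    ((Finset.univ.filter fun v : (R × R) × R × R =>
        v.1.1 * v.2.1 - v.1.2 * v.2.2 = D).card : ℤ)
      = ((Finset.univ.filter fun x : R => ρ x = 0).card : ℤ) ^ 3 * Fintype.card k
        * ((Fintype.card k : ℤ) ^ 2 - 1) := by
  -- A unit among a, b lets one of d, c be solved for; if neither is a unit, the unit D is not
  -- reached.
  have hb : ∀ a b : R, (∑ d : R, ∑ c : R, if a * d - b * c = D then (1 : ℤ) else 0)
      = Fintype.card R - (if ρ a = 0 then 1 else 0) * (if ρ b = 0 then 1 else 0)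
          * Fintype.card R := by
    intro a b
    by_cases ha : ρ a = 0
    · by_cases hb : ρ b = 0
      · have : ∀ d c : R, a * d - b * c ≠ D := by
          rintro d c rfl
          exact hD (by simp [ha, hb])
        simp [ha, hb, this]
      · obtain ⟨u, rfl⟩ := isUnit_of_map_ne_zero ρ hb
        have : ∀ d c : R, a * d - u * c = D ↔ c = ↑u⁻¹ * (a * d - D) := by
          intro d c
          rw [Units.eq_inv_mul_iff_mul_eq]
          constructor <;> intro h <;> linear_combination -h
        simp [this, hb]
    · obtain ⟨u, rfl⟩ := isUnit_of_map_ne_zero ρ ha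
      have : ∀ d c : R, u * d - b * c = D ↔ d = ↑u⁻¹ * (D + b * c) := by
        intro d c
        rw [Units.eq_inv_mul_iff_mul_eq]
        constructor <;> intro h <;> linear_combination h
      rw [Finset.sum_comm]
      simp [this, ha]
  have : ((Finset.univ.filter fun v : (R × R) × R × R =>
        v.1.1 * v.2.1 - v.1.2 * v.2.2 = D).card : ℤ)
      = ∑ a : R, ∑ b : R, ∑ d : R, ∑ c : R, if a * d - b * c = D then (1 : ℤ) else 0 := by
    rw [Finset.card_filter, Nat.cast_sum, Fintype.sum_prod_type, Fintype.sum_prod_type]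
    refine Finset.sum_congr rfl fun a _ => Finset.sum_congr rfl fun b _ => ?_
    rw [← Fintype.sum_prod_type']
    simp
  rw [this, Finset.sum_congr rfl fun a _ => Finset.sum_congr rfl fun b _ => hb a b]
  simp only [Finset.sum_sub_distrib, ← Finset.sum_mul, ← Finset.mul_sum, Finset.sum_boole,
    Finset.sum_const, Finset.card_univ, nsmul_eq_mul, card_eq_card_ker_mul ρ hρ]
  ring

/-- Pairs of vectors whose `x² + bc` values differ by a non-unit `s`, the first value being a
unit with residue in a prescribed set. -/
theorem card_pairs_eq_sum (hρ : Function.Surjective ρ) (h2 : (2 : k) ≠ 0) {s : R}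
    (hs : ρ s = 0) (P : k → Prop) [DecidablePred P] (hP : ∀ a, P a → a ≠ 0) :
    ((Finset.univ.filter fun v : (R × R × R) × (R × R × R) =>
        P (ρ (v.1.1 ^ 2 + v.1.2.1 * v.1.2.2)) ∧
          v.2.1 ^ 2 + v.2.2.1 * v.2.2.2 = v.1.1 ^ 2 + v.1.2.1 * v.1.2.2 + s).card : ℤ)
      = ((Finset.univ.filter fun x : R => ρ x = 0).card : ℤ) ^ 5 * (Fintype.card k : ℤ) ^ 2
        * ∑ a : k, if P a then ((Fintype.card k : ℤ) + quadraticChar k a) ^ 2 else 0 := by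
  set κ : ℤ := ((Finset.univ.filter fun x : R => ρ x = 0).card : ℤ) with hκ
  set q : ℤ := (Fintype.card k : ℤ) with hq
  have hM := fun (D : R) (hD : ρ D ≠ 0) => card_sq_add_mul_eq ρ hρ h2 hD
  simp only [← hκ, ← hq] at hM
  have inner : ∀ v : R × R × R, (∑ w : R × R × R,
      if P (ρ (v.1 ^ 2 + v.2.1 * v.2.2)) ∧
        w.1 ^ 2 + w.2.1 * w.2.2 = v.1 ^ 2 + v.2.1 * v.2.2 + s then (1 : ℤ) else 0)
      = if P (ρ (v.1 ^ 2 + v.2.1 * v.2.2)) then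
          κ ^ 2 * q * (q + quadraticChar k (ρ (v.1 ^ 2 + v.2.1 * v.2.2))) else 0 := by
    intro v
    split_ifs with h
    · have hD : ρ (v.1 ^ 2 + v.2.1 * v.2.2 + s) = ρ (v.1 ^ 2 + v.2.1 * v.2.2) := by
        rw [map_add, hs, add_zero]
      simp only [h, true_and, Finset.sum_boole]
      rw [hM _ (by rw [hD]; exact hP _ h), hD]
    · simp only [h, false_and, if_false, Finset.sum_const_zero]
  -- Grouping v by its value D: `hM` needs D to be a unit, which is guaranteed on the support of F.
  have outer : ∀ F : k → ℤ, (∀ a, ¬ P a → F a = 0) →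
      ∑ v : R × R × R, F (ρ (v.1 ^ 2 + v.2.1 * v.2.2))
        = κ * ∑ a : k, κ ^ 2 * q * (q + quadraticChar k a) * F a := by
    intro F hF
    rw [← sum_comp_eq_card_ker_mul ρ hρ (A := ℤ)
        fun a => κ ^ 2 * q * (q + quadraticChar k a) * F a,
      ← Finset.sum_fiberwise (s := Finset.univ)
        (g := fun v : R × R × R => v.1 ^ 2 + v.2.1 * v.2.2)]
    refine Finset.sum_congr rfl fun D _ => ?_
    have : ∀ v ∈ Finset.univ.filter fun v : R × R × R => v.1 ^ 2 + v.2.1 * v.2.2 = D,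
        F (ρ (v.1 ^ 2 + v.2.1 * v.2.2)) = F (ρ D) :=
      fun v hv => by rw [(Finset.mem_filter.1 hv).2]
    rw [Finset.sum_congr rfl this, Finset.sum_const, nsmul_eq_mul]
    by_cases h : P (ρ D)
    · rw [hM D (hP _ h)]
    · simp [hF _ h]
  rw [Finset.card_filter, Nat.cast_sum, Fintype.sum_prod_type]
  simp only [Nat.cast_ite, Nat.cast_one, Nat.cast_zero]
  rw [Finset.sum_congr rfl fun v _ => inner v,
    outer (fun a => if P a then κ ^ 2 * q * (q + quadraticChar k a) else 0)
      (fun a ha => by simp [ha]), Finset.mul_sum, Finset.mul_sum]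
  refine Finset.sum_congr rfl fun a _ => ?_
  split_ifs <;> ring

/-- Pairs of vectors with `x² + bc` values differing by a non-unit `s`, the first value being
a unit. -/
theorem card_pairs_unit (hρ : Function.Surjective ρ) (h2 : (2 : k) ≠ 0) {s : R}
    (hs : ρ s = 0) :
    ((Finset.univ.filter fun v : (R × R × R) × (R × R × R) =>
        ρ (v.1.1 ^ 2 + v.1.2.1 * v.1.2.2) ≠ 0 ∧
          v.2.1 ^ 2 + v.2.2.1 * v.2.2.2 = v.1.1 ^ 2 + v.1.2.1 * v.1.2.2 + s).card : ℤ)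
      = ((Finset.univ.filter fun x : R => ρ x = 0).card : ℤ) ^ 5 * (Fintype.card k : ℤ) ^ 2
        * ((Fintype.card k - 1) * ((Fintype.card k : ℤ) ^ 2 + 1)) := by
  have hk : ringChar k ≠ 2 := by
    intro h
    apply h2
    have := ringChar.Nat.cast_ringChar (R := k)
    rw [h] at this
    exact_mod_cast this
  rw [card_pairs_eq_sum ρ hρ h2 hs (fun a => a ≠ 0) fun a h => h]
  -- Away from 0, χ² = 1; the last term corrects a = 0, and the part linear in χ sums to zero.
  have : ∀ a : k, (if a ≠ 0 then ((Fintype.card k : ℤ) + quadraticChar k a) ^ 2 else 0)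
      = ((Fintype.card k : ℤ) ^ 2 + 1) + 2 * Fintype.card k * quadraticChar k a
        - if a = 0 then ((Fintype.card k : ℤ) ^ 2 + 1) else 0 := by
    intro a
    by_cases ha : a = 0
    · simp [ha]
    · have := quadraticChar_sq_one ha
      simp only [ha, ne_eq, not_false_eq_true, if_true, if_false]
      linear_combination this
  simp only [this, Finset.sum_sub_distrib, Finset.sum_add_distrib, ← Finset.mul_sum,
    quadraticChar_sum_zero hk, Finset.sum_const, Finset.card_univ, nsmul_eq_mul,
    Finset.sum_ite_eq', Finset.mem_univ, if_true]
  ring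

/-- Pairs of vectors with `x² + bc` values differing by a non-unit `s`, the first value being
congruent to a fixed unit square. -/
theorem card_pairs_square (hρ : Function.Surjective ρ) (h2 : (2 : k) ≠ 0) {s : R}
    (hs : ρ s = 0) {a : k} (ha : a ≠ 0) :
    ((Finset.univ.filter fun v : (R × R × R) × (R × R × R) =>
        ρ (v.1.1 ^ 2 + v.1.2.1 * v.1.2.2) = a ^ 2 ∧
          v.2.1 ^ 2 + v.2.2.1 * v.2.2.2 = v.1.1 ^ 2 + v.1.2.1 * v.1.2.2 + s).card : ℤ)
      = ((Finset.univ.filter fun x : R => ρ x = 0).card : ℤ) ^ 5 * (Fintype.card k : ℤ) ^ 2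
        * (Fintype.card k + 1) ^ 2 := by
  rw [card_pairs_eq_sum ρ hρ h2 hs (fun b => b = a ^ 2) fun b h => h ▸ pow_ne_zero 2 ha]
  rw [Finset.sum_ite_eq' Finset.univ (a ^ 2), if_pos (Finset.mem_univ _),
    quadraticChar_sq_one' ha]

end LocalCounting

/-! ### The split form in six variables over ℤ/pⁿ, counted by content. -/

section Hyperbolic

/-- Fibres of an additive homomorphism over points of its range have the size of the kernel. -/
theorem card_fiber_mul_card_range {A B : Type*} [AddCommGroup A] [AddCommGroup B] [Fintype A]
    [Fintype B] [DecidableEq B] (f : A →+ B) {b : B} (hb : ∃ a, f a = b) :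
    (Finset.univ.filter fun a => f a = b).card * Nat.card f.range = Fintype.card A := by
  obtain ⟨a₀, rfl⟩ := hb
  have h1 : (Finset.univ.filter fun a => f a = f a₀).card = Nat.card f.ker := by
    rw [← Fintype.card_subtype, ← Nat.card_eq_fintype_card]
    exact Nat.card_congr ((Equiv.subRight a₀).subtypeEquiv fun a => by
      simp [AddMonoidHom.mem_ker, sub_eq_zero])
  rw [h1, ← Nat.card_eq_fintype_card, mul_comm, ← AddSubgroup.index_ker f, AddSubgroup.index_mul_card]

variable {p n : ℕ}

theorem card_dvd_pow (hp : p.Prime) {j : ℕ} (hj : j ≤ n) :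
    Nat.card {x : ZMod (p ^ n) // (p : ZMod (p ^ n)) ^ j ∣ x} = p ^ (n - j) := by
  have h1 : Nat.card {x : ZMod (p ^ n) // (p : ZMod (p ^ n)) ^ j ∣ x}
      = Nat.card (AddSubgroup.zmultiples ((p ^ j : ℕ) : ZMod (p ^ n))) := by
    refine Nat.card_congr (Equiv.subtypeEquivRight fun x => ?_)
    rw [AddSubgroup.mem_zmultiples_iff]
    constructor
    · rintro ⟨y, rfl⟩
      obtain ⟨m, rfl⟩ := ZMod.intCast_surjective y
      exact ⟨m, by simp [mul_comm]⟩
    · rintro ⟨m, rfl⟩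
      exact ⟨m, by simp [mul_comm]⟩
  rw [h1, Nat.card_zmultiples, ZMod.addOrderOf_coe _ (pow_ne_zero _ hp.ne_zero),
    Nat.gcd_eq_right (pow_dvd_pow p hj), Nat.pow_div hj hp.pos]

theorem isUnit_of_not_dvd (hp : p.Prime) {x : ZMod (p ^ n)} (hx : ¬ (p : ZMod (p ^ n)) ∣ x) :
    IsUnit x := by
  have : NeZero (p ^ n) := ⟨pow_ne_zero _ hp.ne_zero⟩
  obtain ⟨m, rfl⟩ := ZMod.natCast_zmod_surjective (n := p ^ n) x
  rw [ZMod.isUnit_iff_coprime]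
  exact (((hp.coprime_iff_not_dvd).2 fun h => hx (Nat.cast_dvd_cast h)).symm).pow_right n

/-- Vectors with all coordinates divisible by `p ^ j`. -/
theorem card_forall_dvd_pow (hp : p.Prime) {j : ℕ} (hj : j ≤ n) :
    Nat.card {u : Fin 3 → ZMod (p ^ n) // ∀ i, (p : ZMod (p ^ n)) ^ j ∣ u i}
      = p ^ (3 * (n - j)) := by
  rw [Nat.card_congr (Equiv.subtypePiEquivPi (p := fun _ x => (p : ZMod (p ^ n)) ^ j ∣ x)),
    Nat.card_pi]
  simp [card_dvd_pow hp hj, ← pow_mul, mul_comm]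

/-- The linear form attached to a vector of content `p ^ j` takes each multiple of `p ^ j`
equally often. -/
theorem card_dotProduct_eq [NeZero (p ^ n)] (hp : p.Prime) {j : ℕ} (hj : j ≤ n)
    {s : ZMod (p ^ n)} (hs : (p : ZMod (p ^ n)) ^ j ∣ s) {u : Fin 3 → ZMod (p ^ n)}
    (hu : ∀ i, (p : ZMod (p ^ n)) ^ j ∣ u i) (hu' : ¬ ∀ i, (p : ZMod (p ^ n)) ^ (j + 1) ∣ u i) :
    (Finset.univ.filter fun w => u ⬝ᵥ w = s).card = p ^ (2 * n + j) := by
  let f : (Fin 3 → ZMod (p ^ n)) →+ ZMod (p ^ n) :=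
    { toFun := fun w => u ⬝ᵥ w
      map_zero' := dotProduct_zero u
      map_add' := dotProduct_add u }
  -- Some coordinate of u is p^j times a unit, so that coordinate alone already reaches every
  -- multiple of p^j.
  have hf : ∀ r, r ∈ f.range ↔ (p : ZMod (p ^ n)) ^ j ∣ r := by
    intro r
    constructor
    · rintro ⟨w, rfl⟩
      change _ ∣ u ⬝ᵥ w
      exact Finset.dvd_sum fun i _ => (hu i).mul_right _
    · rintro ⟨y, rfl⟩
      push Not at hu'
      obtain ⟨i, hi⟩ := hu'
      obtain ⟨z, hz⟩ := hu i
      obtain ⟨z, rfl⟩ : IsUnit z := isUnit_of_not_dvd hp (by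
        rintro ⟨t, rfl⟩
        exact hi ⟨t, by rw [hz]; ring⟩)
      refine ⟨Pi.single i (↑z⁻¹ * y), ?_⟩
      change u ⬝ᵥ _ = _
      rw [dotProduct_single, hz, mul_assoc, Units.mul_inv_cancel_left]
  have h1 := card_fiber_mul_card_range f ((hf s).2 hs)
  have h2 : Nat.card f.range = p ^ (n - j) := by
    rw [← card_dvd_pow hp hj]
    exact Nat.card_congr (Equiv.subtypeEquivRight hf)
  rw [h2, Fintype.card_fun, ZMod.card, Fintype.card_fin] at h1
  have h3 : p ^ (2 * n + j) * p ^ (n - j) = (p ^ n) ^ 3 := by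
    rw [← pow_add, ← pow_mul]; congr 1; omega
  exact Nat.eq_of_mul_eq_mul_right (pow_pos hp.pos _) (h1.trans h3.symm)

/-- Number of representations of `s` with valuation `v < n` by `u₀w₀ + u₁w₁ + u₂w₂`. -/
theorem card_dotProduct_pairs [NeZero (p ^ n)] (hp : p.Prime) {v : ℕ} (hv : v + 1 ≤ n)
    {s : ZMod (p ^ n)} (hs : (p : ZMod (p ^ n)) ^ v ∣ s)
    (hs' : ¬ (p : ZMod (p ^ n)) ^ (v + 1) ∣ s) :
    ((Finset.univ.filter fun x : (Fin 3 → ZMod (p ^ n)) × (Fin 3 → ZMod (p ^ n)) =>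
        x.1 ⬝ᵥ x.2 = s).card : ℚ) * ((p : ℚ) ^ (2 * v + 3) * ((p : ℚ) ^ 2 - 1))
      = (p : ℚ) ^ (5 * n) * ((p : ℚ) ^ 3 - 1) * ((p : ℚ) ^ (2 * v + 2) - 1) := by
  classical
  set F : (Fin 3 → ZMod (p ^ n)) → ℚ :=
    fun u => ((Finset.univ.filter fun w => u ⬝ᵥ w = s).card : ℚ) with hF
  let U : ℕ → Finset (Fin 3 → ZMod (p ^ n)) :=
    fun j => Finset.univ.filter fun u => ∀ i, (p : ZMod (p ^ n)) ^ j ∣ u i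
  have hU : ∀ j ≤ n, ((U j).card : ℚ) = (p : ℚ) ^ (3 * (n - j)) := by
    intro j hj
    have := card_forall_dvd_pow hp hj
    rw [Nat.card_eq_fintype_card, Fintype.card_subtype] at this
    simp only [U, this, Nat.cast_pow]
  have hmono : ∀ j, U (j + 1) ⊆ U j := by
    intro j u hu
    simp only [U, Finset.mem_filter, Finset.mem_univ, true_and] at hu ⊢
    exact fun i => (pow_dvd_pow _ j.le_succ).trans (hu i)
  -- Peels off the vectors of content exactly p^j, each of which has p^(2n+j) partners.
  have hstep : ∀ j ≤ v, ∑ u ∈ U j, F u = ∑ u ∈ U (j + 1), F u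
      + ((p : ℚ) ^ (3 * (n - j)) - (p : ℚ) ^ (3 * (n - (j + 1)))) * (p : ℚ) ^ (2 * n + j) := by
    intro j hj
    rw [← Finset.sum_sdiff (hmono j), add_comm]
    congr 1
    rw [Finset.sum_congr rfl (g := fun _ => (p : ℚ) ^ (2 * n + j)), Finset.sum_const,
      nsmul_eq_mul, Finset.card_sdiff_of_subset (hmono j),
      Nat.cast_sub (Finset.card_le_card (hmono j)), hU j (by omega), hU (j + 1) (by omega)]
    intro u hu
    simp only [U, Finset.mem_sdiff, Finset.mem_filter, Finset.mem_univ, true_and] at hu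
    simp only [hF]
    rw [card_dotProduct_eq hp (by omega) ((pow_dvd_pow _ hj).trans hs) hu.1 hu.2]
    push_cast
    rfl
  have hzero : ∑ u ∈ U (v + 1), F u = 0 := by
    refine Finset.sum_eq_zero fun u hu => ?_
    simp only [U, Finset.mem_filter, Finset.mem_univ, true_and] at hu
    simp only [hF, Nat.cast_eq_zero, Finset.card_eq_zero, Finset.filter_eq_empty_iff]
    rintro w - rfl
    exact hs' (Finset.dvd_sum fun i _ => (hu i).mul_right _)
  have hp0 : (p : ℚ) ≠ 0 := by exact_mod_cast hp.ne_zero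
  -- A geometric sum with ratio p², cleared of denominators: i counts the strata added, from content
  -- p^v down to content 1.
  have hclosed : ∀ i ≤ v + 1, (∑ u ∈ U (v + 1 - i), F u) * ((p : ℚ) ^ (2 * v + 3) * ((p : ℚ) ^ 2 - 1))
      = (p : ℚ) ^ (5 * n) * ((p : ℚ) ^ 3 - 1) * ((p : ℚ) ^ (2 * i) - 1) := by
    intro i
    induction i with
    | zero => intro _; simp [hzero]
    | succ i ih =>
      intro hi
      obtain ⟨j, rfl⟩ : ∃ j, v = j + i := ⟨v - i, by omega⟩
      have e1 : j + i + 1 - (i + 1) = j := by omega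
      have e2 : j + i + 1 - i = j + 1 := by omega
      rw [e1, hstep j (by omega), add_mul]
      rw [e2] at ih
      rw [ih (by omega)]
      obtain ⟨m, rfl⟩ : ∃ m, n = m + (j + 1) := ⟨n - (j + 1), by omega⟩
      have e3 : m + (j + 1) - j = m + 1 := by omega
      rw [e3, Nat.add_sub_cancel]
      ring
  have := hclosed (v + 1) le_rfl
  rw [Nat.sub_self, mul_add 2 v 1] at this
  rw [← this]
  congr 1
  rw [Finset.card_filter, Nat.cast_sum, Fintype.sum_prod_type]
  simp [U, hF]

/-- The same count for the difference of two values of `x² + bc`. -/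
theorem card_sq_add_mul_pairs [NeZero (p ^ n)] (hp : p.Prime) (hp2 : p ≠ 2) {v : ℕ}
    (hv : v + 1 ≤ n) {s : ZMod (p ^ n)} (hs : (p : ZMod (p ^ n)) ^ v ∣ s)
    (hs' : ¬ (p : ZMod (p ^ n)) ^ (v + 1) ∣ s) :
    ((Finset.univ.filter fun x : (ZMod (p ^ n) × ZMod (p ^ n) × ZMod (p ^ n)) ×
        (ZMod (p ^ n) × ZMod (p ^ n) × ZMod (p ^ n)) =>
        x.2.1 ^ 2 + x.2.2.1 * x.2.2.2 = x.1.1 ^ 2 + x.1.2.1 * x.1.2.2 + s).card : ℚ)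
        * ((p : ℚ) ^ (2 * v + 3) * ((p : ℚ) ^ 2 - 1))
      = (p : ℚ) ^ (5 * n) * ((p : ℚ) ^ 3 - 1) * ((p : ℚ) ^ (2 * v + 2) - 1) := by
  rw [← card_dotProduct_pairs hp hv hs hs']
  congr 2
  obtain ⟨h, hh⟩ : ∃ h : ZMod (p ^ n), 2 * h = 1 := by
    have h2 : IsUnit ((2 : ℕ) : ZMod (p ^ n)) := by
      rw [ZMod.isUnit_iff_coprime]
      exact ((Nat.coprime_primes Nat.prime_two hp).2 hp2.symm).pow_right n
    obtain ⟨h, hh⟩ := h2.exists_right_inv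
    exact ⟨h, by exact_mod_cast hh⟩
  -- Uses x'² - x² = (x' - x)(x' + x), with b'c' and -bc as the two other products; h = 1/2 inverts
  -- the change of variables.
  refine Finset.card_bij'
    (fun x _ => (![x.2.1 - x.1.1, x.2.2.1, -x.1.2.1], ![x.2.1 + x.1.1, x.2.2.2, x.1.2.2]))
    (fun y _ => ((h * (y.2 0 - y.1 0), -y.1 2, y.2 2), (h * (y.2 0 + y.1 0), y.1 1, y.2 1)))
    ?_ ?_ ?_ ?_
  · rintro ⟨⟨a, b, c⟩, a', b', c'⟩ hx
    simp [dotProduct, Fin.sum_univ_three] at hx ⊢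
    linear_combination hx
  · rintro ⟨u, w⟩ hx
    simp [dotProduct, Fin.sum_univ_three] at hx ⊢
    linear_combination hx + (2 * h + 1) * u 0 * w 0 * hh
  · rintro ⟨⟨a, b, c⟩, a', b', c'⟩ hx
    simp
    constructor
    · linear_combination a * hh
    · linear_combination a' * hh
  · rintro ⟨u, w⟩ hx
    simp
    constructor
    · ext i; fin_cases i <;> simp
      linear_combination u 0 * hh
    · ext i; fin_cases i <;> simp
      linear_combination w 0 * hh

end Hyperbolic

/-! ### Coordinates on G(m, T) and G(m). -/

section Parametrization

variable {m : ℕ} [NeZero m] {k : Type*} [Field k] [DecidableEq k] (ρ : ZMod m →+* k)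
  [IsLocalHom ρ]

/-- Pairs in `G(m, T)`, parametrized by the trace of the first matrix and the traceless parts. -/
theorem card_GModTrace {h : ZMod m} (hh : 2 * h = 1) (T : ℤ) :
    Nat.card (GModTrace m T)
      = (Finset.univ.filter fun x : ZMod m × (ZMod m × ZMod m × ZMod m) ×
            (ZMod m × ZMod m × ZMod m) =>
          ρ (x.1 ^ 2 - (x.2.1.1 ^ 2 + x.2.1.2.1 * x.2.1.2.2)) ≠ 0 ∧
            x.2.2.1 ^ 2 + x.2.2.2.1 * x.2.2.2.2
              = x.2.1.1 ^ 2 + x.2.1.2.1 * x.2.1.2.2 + T * (T - 2 * x.1)).card := by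
  have h2 : IsUnit (2 : ZMod m) := IsUnit.of_mul_eq_one _ hh
  rw [← Fintype.card_subtype, ← Nat.card_eq_fintype_card]
  have htr : ∀ g : GModTrace m T,
      g.1.1.1.1 0 0 + g.1.1.1.1 1 1 + (g.1.1.2.1 0 0 + g.1.1.2.1 1 1) = (T : ZMod m) := by
    intro g
    have := g.2
    simp only [GModTrace, Set.mem_ofPred_eq, Matrix.trace_fin_two] at this
    exact this
  have hdet : ∀ g : GModTrace m T,
      g.1.1.1.1 0 0 * g.1.1.1.1 1 1 - g.1.1.1.1 0 1 * g.1.1.1.1 1 0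
        = g.1.1.2.1 0 0 * g.1.1.2.1 1 1 - g.1.1.2.1 0 1 * g.1.1.2.1 1 0 := by
    intro g
    have := g.1.2
    simp only [GLTwoDet, ← Subgroup.mem_carrier, Set.mem_ofPred_eq, Matrix.det_fin_two] at this
    exact this
  have hunit : ∀ g : GL (Fin 2) (ZMod m),
      IsUnit (g.1 0 0 * g.1 1 1 - g.1 0 1 * g.1 1 0) := by
    intro g
    rw [← Matrix.det_fin_two]
    exact (Matrix.isUnit_iff_isUnit_det _).1 g.isUnit
  -- Doubling the off-diagonal entries makes 4 det equal to t² - (x² + bc), with no halves left in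
  -- the equation.
  refine Nat.card_eq_of_bijective (fun g => ⟨(g.1.1.1.1 0 0 + g.1.1.1.1 1 1,
    (g.1.1.1.1 0 0 - g.1.1.1.1 1 1, 2 * g.1.1.1.1 0 1, 2 * g.1.1.1.1 1 0),
    (g.1.1.2.1 0 0 - g.1.1.2.1 1 1, 2 * g.1.1.2.1 0 1, 2 * g.1.1.2.1 1 0)), ?_, ?_⟩) ⟨?_, ?_⟩
  · dsimp only
    have := (h2.mul h2).mul (hunit g.1.1.1)
    have e := (this.map ρ).ne_zero
    convert e using 2
    ring
  · dsimp only
    rw [← htr g]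
    linear_combination 4 * hdet g
  · intro g g' hgg
    simp only [Subtype.mk.injEq, Prod.mk.injEq] at hgg
    obtain ⟨e1, ⟨e2, e3, e4⟩, e5, e6, e7⟩ := hgg
    have e8 := (htr g).trans (htr g').symm
    apply Subtype.ext
    apply Subtype.ext
    refine Prod.ext (Units.ext (Matrix.ext fun i j => ?_)) (Units.ext (Matrix.ext fun i j => ?_))
    · apply h2.mul_left_cancel
      fin_cases i <;> fin_cases j <;> simp only [Fin.zero_eta, Fin.mk_one]
      · linear_combination e1 + e2
      · exact e3
      · exact e4
      · linear_combination e1 - e2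
    · apply h2.mul_left_cancel
      fin_cases i <;> fin_cases j <;> simp only [Fin.zero_eta, Fin.mk_one]
      · linear_combination e8 - e1 + e5
      · exact e6
      · exact e7
      · linear_combination e8 - e1 - e5
  · rintro ⟨⟨t, ⟨x, b, c⟩, x', b', c'⟩, hne, heq⟩
    dsimp only at hne heq
    have hU := isUnit_of_map_ne_zero ρ hne
    have hh' : IsUnit h := IsUnit.of_mul_eq_one_right _ hh
    let A : Matrix (Fin 2) (Fin 2) (ZMod m) := !![h * (t + x), h * b; h * c, h * (t - x)]
    let B : Matrix (Fin 2) (Fin 2) (ZMod m) :=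
      !![h * (T - t + x'), h * b'; h * c', h * (T - t - x')]
    have hA : A.det = h * h * (t ^ 2 - (x ^ 2 + b * c)) := by
      simp only [A, Matrix.det_fin_two_of]; ring
    have hB : B.det = h * h * (t ^ 2 - (x ^ 2 + b * c)) := by
      simp only [B, Matrix.det_fin_two_of]; linear_combination - h * h * heq
    have hu : IsUnit (h * h * (t ^ 2 - (x ^ 2 + b * c))) := (hh'.mul hh').mul hU
    refine ⟨⟨⟨(Matrix.GeneralLinearGroup.mk'' A (hA ▸ hu),
      Matrix.GeneralLinearGroup.mk'' B (hB ▸ hu)), ?_⟩, ?_⟩, ?_⟩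
    · exact hA.trans hB.symm
    · change A.trace + B.trace = (T : ZMod m)
      simp only [A, B, Matrix.trace_fin_two_of]
      linear_combination (T : ZMod m) * hh
    · apply Subtype.ext
      change (A 0 0 + A 1 1, (A 0 0 - A 1 1, 2 * A 0 1, 2 * A 1 0),
        (B 0 0 - B 1 1, 2 * B 0 1, 2 * B 1 0)) = _
      simp only [A, B, Matrix.of_apply, Matrix.cons_val', Matrix.cons_val_zero,
        Matrix.cons_val_one, Matrix.cons_val_fin_one, Prod.mk.injEq]
      refine ⟨?_, ⟨?_, ?_, ?_⟩, ?_, ?_, ?_⟩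
      · linear_combination t * hh
      · linear_combination x * hh
      · linear_combination b * hh
      · linear_combination c * hh
      · linear_combination x' * hh
      · linear_combination b' * hh
      · linear_combination c' * hh

/-- Pairs in `G(m)` in coordinates. -/
theorem card_GMod :
    Nat.card (GMod m)
      = (Finset.univ.filter fun x : ((ZMod m × ZMod m) × ZMod m × ZMod m) ×
            (ZMod m × ZMod m) × ZMod m × ZMod m =>
          ρ (x.1.1.1 * x.1.2.1 - x.1.1.2 * x.1.2.2) ≠ 0 ∧
            x.2.1.1 * x.2.2.1 - x.2.1.2 * x.2.2.2
              = x.1.1.1 * x.1.2.1 - x.1.1.2 * x.1.2.2).card := by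
  rw [← Fintype.card_subtype, ← Nat.card_eq_fintype_card]
  refine Nat.card_eq_of_bijective (fun g => ⟨(((g.1.1.1 0 0, g.1.1.1 0 1),
    (g.1.1.1 1 1, g.1.1.1 1 0)), ((g.1.2.1 0 0, g.1.2.1 0 1),
    (g.1.2.1 1 1, g.1.2.1 1 0))), ?_, ?_⟩) ⟨?_, ?_⟩
  · dsimp only
    rw [← Matrix.det_fin_two]
    exact (((Matrix.isUnit_iff_isUnit_det _).1 g.1.1.isUnit).map ρ).ne_zero
  · have := g.2
    simp only [GLTwoDet, ← Subgroup.mem_carrier, Set.mem_ofPred_eq, Matrix.det_fin_two] at this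
    exact this.symm
  · intro g g' hgg
    simp only [Subtype.mk.injEq, Prod.mk.injEq] at hgg
    obtain ⟨⟨⟨e1, e2⟩, e3, e4⟩, ⟨e5, e6⟩, e7, e8⟩ := hgg
    apply Subtype.ext
    refine Prod.ext (Units.ext (Matrix.ext fun i j => ?_)) (Units.ext (Matrix.ext fun i j => ?_))
    · fin_cases i <;> fin_cases j <;> assumption
    · fin_cases i <;> fin_cases j <;> assumption
  · rintro ⟨⟨⟨⟨a, b⟩, d, c⟩, ⟨a', b'⟩, d', c'⟩, hne, heq⟩
    dsimp only at hne heq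
    have hU := isUnit_of_map_ne_zero ρ hne
    have hA : (!![a, b; c, d]).det = a * d - b * c := Matrix.det_fin_two_of _ _ _ _
    have hB : (!![a', b'; c', d']).det = a * d - b * c :=
      (Matrix.det_fin_two_of _ _ _ _).trans heq
    exact ⟨⟨(Matrix.GeneralLinearGroup.mk'' _ (hA ▸ hU),
      Matrix.GeneralLinearGroup.mk'' _ (hB ▸ hU)), hA.trans hB.symm⟩, rfl⟩

end Parametrization

/-! ### Both group counts at a prime power, via reduction to ℤ/p. -/

section PrimePower

variable {p n : ℕ} [Fact p.Prime]

theorem isLocalHom_castHom_prime (hn : n ≠ 0) :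
    IsLocalHom (ZMod.castHom (dvd_pow_self p hn) (ZMod p)) := by
  have hp : p.Prime := Fact.out
  have : NeZero (p ^ n) := ⟨pow_ne_zero _ hp.ne_zero⟩
  refine ⟨fun x hx => ?_⟩
  obtain ⟨a, rfl⟩ := ZMod.natCast_zmod_surjective (n := p ^ n) x
  rw [map_natCast, ZMod.isUnit_iff_coprime] at hx
  rw [ZMod.isUnit_iff_coprime]
  exact hx.pow_right n

theorem card_ker_castHom_prime [NeZero (p ^ n)] (hn : n ≠ 0) :
    (Finset.univ.filter fun x : ZMod (p ^ n) =>
      ZMod.castHom (dvd_pow_self p hn) (ZMod p) x = 0).card = p ^ (n - 1) := by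
  have hp : p.Prime := Fact.out
  have := card_eq_card_ker_mul (ZMod.castHom (dvd_pow_self p hn) (ZMod p))
    (ZMod.castHom_surjective _)
  rw [ZMod.card, ZMod.card] at this
  norm_cast at this
  obtain ⟨m, rfl⟩ := Nat.exists_eq_succ_of_ne_zero hn
  exact (Nat.eq_of_mul_eq_mul_right hp.pos ((pow_succ p m).symm.trans this)).symm

/-- Every unit D is the determinant of the same number C of matrices, so the count is C² times the
number of units. -/
theorem card_GMod_prime_pow (hn : n ≠ 0) :
    (Nat.card (GMod (p ^ n)) : ℤ)
      = (p : ℤ) ^ (7 * (n - 1)) * (p - 1) * p ^ 2 * ((p : ℤ) ^ 2 - 1) ^ 2 := by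
  have hp : p.Prime := Fact.out
  have : NeZero (p ^ n) := ⟨pow_ne_zero _ hp.ne_zero⟩
  let ρ := ZMod.castHom (dvd_pow_self p hn) (ZMod p)
  have hloc : IsLocalHom ρ := isLocalHom_castHom_prime hn
  have hρ : Function.Surjective ρ := ZMod.castHom_surjective _
  have hκ : (Finset.univ.filter fun x => ρ x = 0).card = p ^ (n - 1) :=
    card_ker_castHom_prime hn
  have hC := fun (D : ZMod (p ^ n)) (hD : ρ D ≠ 0) => card_det_eq ρ hρ hD
  set C : ℤ := ((Finset.univ.filter fun x => ρ x = 0).card : ℤ) ^ 3 * Fintype.card (ZMod p)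
        * ((Fintype.card (ZMod p) : ℤ) ^ 2 - 1) with hCdef
  rw [card_GMod ρ, Finset.card_filter, Nat.cast_sum, Fintype.sum_prod_type]
  simp only [Nat.cast_ite, Nat.cast_one, Nat.cast_zero]
  have inner : ∀ v : (ZMod (p ^ n) × ZMod (p ^ n)) × ZMod (p ^ n) × ZMod (p ^ n),
      (∑ w : (ZMod (p ^ n) × ZMod (p ^ n)) × ZMod (p ^ n) × ZMod (p ^ n),
        if ρ (v.1.1 * v.2.1 - v.1.2 * v.2.2) ≠ 0 ∧
          w.1.1 * w.2.1 - w.1.2 * w.2.2 = v.1.1 * v.2.1 - v.1.2 * v.2.2 then (1 : ℤ) else 0)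
      = if ρ (v.1.1 * v.2.1 - v.1.2 * v.2.2) ≠ 0 then C else 0 := by
    intro v
    split_ifs with h
    · simp only [ne_eq, h, not_false_eq_true, true_and, Finset.sum_boole]
      exact hC _ h
    · simp only [h, false_and, if_false, Finset.sum_const_zero]
  rw [Finset.sum_congr rfl fun v _ => inner v,
    ← Finset.sum_fiberwise (s := Finset.univ)
      (g := fun v : (ZMod (p ^ n) × ZMod (p ^ n)) × ZMod (p ^ n) × ZMod (p ^ n) =>
        v.1.1 * v.2.1 - v.1.2 * v.2.2)]
  have outer : ∀ D : ZMod (p ^ n),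
      (∑ v ∈ Finset.univ.filter fun v : (ZMod (p ^ n) × ZMod (p ^ n)) × ZMod (p ^ n) ×
          ZMod (p ^ n) => v.1.1 * v.2.1 - v.1.2 * v.2.2 = D,
        if ρ (v.1.1 * v.2.1 - v.1.2 * v.2.2) ≠ 0 then C else 0)
      = if ρ D = 0 then 0 else C ^ 2 := by
    intro D
    rw [Finset.sum_congr rfl (g := fun _ => if ρ D ≠ 0 then C else 0)
      fun v hv => by rw [(Finset.mem_filter.1 hv).2], Finset.sum_const, nsmul_eq_mul]
    by_cases h : ρ D = 0
    · simp [h]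
    · rw [hC D h]; simp only [ne_eq, h, not_false_eq_true, if_true, if_false]; ring
  rw [Finset.sum_congr rfl fun D _ => outer D,
    sum_comp_eq_card_ker_mul ρ hρ (A := ℤ) fun a => if a = 0 then 0 else C ^ 2,
    Finset.sum_ite, Finset.sum_const_zero, zero_add, Finset.sum_const, Finset.filter_ne',
    Finset.card_erase_of_mem (Finset.mem_univ _), Finset.card_univ, nsmul_eq_mul, hCdef, hκ,
    ZMod.card]
  push_cast [hp.one_le]
  ring

/-- The factor p^(n-1) is the number of traces t in each residue class; the zero class and the p - 1
nonzero classes contribute the two summands. -/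
theorem card_GModTrace_prime_pow (hp2 : p ≠ 2) {T : ℤ} (hT : T ≠ 0) (hpT : (p : ℤ) ∣ T)
    (hn : padicValInt p T + 1 ≤ n) :
    (Nat.card (GModTrace (p ^ n) T) : ℚ)
      = (p : ℚ) ^ (n - 1) * ((p : ℚ) ^ (5 * (n - 1)) * (p : ℚ) ^ 2 * ((p - 1) * ((p : ℚ) ^ 2 + 1))
        + (p - 1) * ((p : ℚ) ^ (5 * n) * ((p : ℚ) ^ 3 - 1)
              * ((p : ℚ) ^ (2 * padicValInt p T + 2) - 1)
              / ((p : ℚ) ^ (2 * padicValInt p T + 3) * ((p : ℚ) ^ 2 - 1))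
            - (p : ℚ) ^ (5 * (n - 1)) * (p : ℚ) ^ 2 * (p + 1) ^ 2)) := by
  have hp : p.Prime := Fact.out
  have : NeZero (p ^ n) := ⟨pow_ne_zero _ hp.ne_zero⟩
  have hn0 : n ≠ 0 := by omega
  let ρ := ZMod.castHom (dvd_pow_self p hn0) (ZMod p)
  have hloc : IsLocalHom ρ := isLocalHom_castHom_prime hn0
  have hρ : Function.Surjective ρ := ZMod.castHom_surjective _
  have hκ : (Finset.univ.filter fun x => ρ x = 0).card = p ^ (n - 1) :=
    card_ker_castHom_prime hn0
  have h2 : (2 : ZMod p) ≠ 0 := by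
    have : ((2 : ℕ) : ZMod p) ≠ 0 := by
      rw [Ne, ZMod.natCast_eq_zero_iff, Nat.prime_dvd_prime_iff_eq hp Nat.prime_two]
      exact hp2
    exact_mod_cast this
  obtain ⟨h, hh⟩ : ∃ h : ZMod (p ^ n), 2 * h = 1 :=
    (isUnit_of_map_ne_zero ρ (by rwa [map_ofNat])).exists_right_inv
  have hρT : ρ T = 0 := by
    rw [map_intCast]; exact (ZMod.intCast_zmod_eq_zero_iff_dvd _ _).2 hpT
  set v := padicValInt p T with hv
  have hdvd : (p : ZMod (p ^ n)) ^ v ∣ T := by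
    have := Int.cast_dvd_cast (α := ZMod (p ^ n)) _ _ (padicValInt_dvd (p := p) T)
    push_cast at this
    exact this
  have hndvd : ¬ (p : ZMod (p ^ n)) ^ (v + 1) ∣ T := by
    intro hd
    -- Modulo p^(v+1), which divides pⁿ because n ≥ v + 1, divisibility becomes vanishing of T.
    have h1 := map_dvd (ZMod.castHom (pow_dvd_pow p hn) (ZMod (p ^ (v + 1)))) hd
    rw [map_pow, map_natCast, map_intCast, ← Nat.cast_pow, ZMod.natCast_self, zero_dvd_iff,
      ZMod.intCast_zmod_eq_zero_iff_dvd, Nat.cast_pow, padicValInt_dvd_iff] at h1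
    rcases h1 with h1 | h1
    · exact hT h1
    · omega
  have hp1 : (1 : ℚ) < p := by exact_mod_cast hp.one_lt
  have hden : ((p : ℚ) ^ (2 * v + 3) * ((p : ℚ) ^ 2 - 1)) ≠ 0 :=
    mul_ne_zero (pow_ne_zero _ (by positivity)) (by nlinarith)
  let V := ZMod (p ^ n) × ZMod (p ^ n) × ZMod (p ^ n)
  let c₁ : ℚ := (p : ℚ) ^ (5 * (n - 1)) * (p : ℚ) ^ 2 * ((p - 1) * ((p : ℚ) ^ 2 + 1))
  let c₂ : ℚ := (p : ℚ) ^ (5 * n) * ((p : ℚ) ^ 3 - 1) * ((p : ℚ) ^ (2 * v + 2) - 1)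
      / ((p : ℚ) ^ (2 * v + 3) * ((p : ℚ) ^ 2 - 1))
      - (p : ℚ) ^ (5 * (n - 1)) * (p : ℚ) ^ 2 * (p + 1) ^ 2
  have inner : ∀ t : ZMod (p ^ n), ((Finset.univ.filter fun x : V × V =>
        ρ (t ^ 2 - (x.1.1 ^ 2 + x.1.2.1 * x.1.2.2)) ≠ 0 ∧
          x.2.1 ^ 2 + x.2.2.1 * x.2.2.2
            = x.1.1 ^ 2 + x.1.2.1 * x.1.2.2 + T * (T - 2 * t)).card : ℚ)
      = if ρ t = 0 then c₁ else c₂ := by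
    intro t
    have hs : ρ (T * (T - 2 * t)) = 0 := by rw [map_mul, hρT, zero_mul]
    split_ifs with ht
    · have := card_pairs_unit ρ hρ h2 hs
      rw [hκ, ZMod.card] at this
      have e : ∀ a : ZMod (p ^ n), ρ (t ^ 2 - a) ≠ 0 ↔ ρ a ≠ 0 := by
        intro a; rw [map_sub, map_pow, ht]; simp
      simp only [e]
      have := congrArg (Int.cast : ℤ → ℚ) this
      push_cast at this
      rw [this]
      simp only [c₁]
      ring
    · have hu : IsUnit (T - 2 * t : ZMod (p ^ n)) := isUnit_of_map_ne_zero ρ (by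
        rw [map_sub, hρT, map_mul, zero_sub, map_ofNat]
        exact neg_ne_zero.2 (mul_ne_zero h2 ht))
      have hN := card_sq_add_mul_pairs (n := n) hp hp2 hn (s := T * (T - 2 * t))
        (hdvd.mul_right _) (by rwa [hu.dvd_mul_right])
      rw [← eq_div_iff hden] at hN
      have hsq := congrArg (Int.cast : ℤ → ℚ) (card_pairs_square ρ hρ h2 hs ht)
      rw [hκ, ZMod.card] at hsq
      push_cast at hsq
      -- For t a unit the admissible pairs are the complement, among all solutions, of those where
      -- t² - Q(v) is a non-unit.
      have hsplit := Finset.card_filter_add_card_filter_not (s := Finset.univ.filter fun x : V × V =>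
        x.2.1 ^ 2 + x.2.2.1 * x.2.2.2 = x.1.1 ^ 2 + x.1.2.1 * x.1.2.2 + T * (T - 2 * t))
        (fun x => ρ (x.1.1 ^ 2 + x.1.2.1 * x.1.2.2) = ρ t ^ 2)
      have e : ∀ a : ZMod (p ^ n), ρ (t ^ 2 - a) ≠ 0 ↔ ¬ ρ a = ρ t ^ 2 := by
        intro a; rw [map_sub, map_pow, sub_ne_zero, ne_comm]
      simp only [Finset.filter_filter, and_comm] at hsplit hN hsq
      simp only [e, and_comm]
      have hsplit' := congrArg (Nat.cast : ℕ → ℚ) hsplit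
      push_cast at hsplit'
      rw [hsq, hN, ← eq_sub_iff_add_eq'] at hsplit'
      rw [hsplit']
      simp only [c₂]
      ring
  rw [card_GModTrace ρ hh T, Finset.card_filter, Nat.cast_sum, Fintype.sum_prod_type]
  have outer : ∀ t : ZMod (p ^ n), (∑ x : V × V, (((if
        ρ (t ^ 2 - (x.1.1 ^ 2 + x.1.2.1 * x.1.2.2)) ≠ 0 ∧
          x.2.1 ^ 2 + x.2.2.1 * x.2.2.2
            = x.1.1 ^ 2 + x.1.2.1 * x.1.2.2 + T * (T - 2 * t) then 1 else 0 : ℕ) : ℕ) : ℚ))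
      = if ρ t = 0 then c₁ else c₂ := by
    intro t
    rw [← inner t, Finset.card_filter, Nat.cast_sum]
  rw [Finset.sum_congr rfl fun t _ => outer t,
    sum_comp_eq_card_ker_mul ρ hρ (A := ℚ) fun a => if a = 0 then c₁ else c₂, hκ,
    Finset.sum_ite, Finset.sum_const, Finset.sum_const, Finset.filter_ne',
    Finset.card_erase_of_mem (Finset.mem_univ _), Finset.card_univ, ZMod.card,
    Finset.filter_eq']
  simp only [Finset.mem_univ, if_true, Finset.card_singleton, nsmul_eq_mul, c₁, c₂]
  push_cast [hp.one_le]
  ring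

end PrimePower

/-! ### Closed formula, limit, and denominator of E. -/

theorem theorem3p6 (l : ℕ) (hl : l.Prime) (hl2 : l ≠ 2) (T : ℤ) (hT : T ≠ 0)
    (hlT : (l : ℤ) ∣ T) :
    (∀ n : ℕ, padicValInt l T + 1 ≤ n →
      (Nat.card (GModTrace (l ^ n) T) : ℚ)
        = ((l : ℚ) - 1) * (l : ℚ) ^ (6 * (n : ℤ) - 4 * (eFloor l T : ℤ) - 9)
          * ((l : ℚ) ^ (4 * eFloor l T + 3)
                * ((l : ℚ) ^ 5 - (l : ℚ) ^ 3 - 3 * (l : ℚ) ^ 2 + 1)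
              + EQuot l T
              + (l : ℚ) * (deltaDvd 2 (padicValInt l T) : ℚ) * ((l : ℚ) ^ 3 - 1)))
    ∧ Tendsto
        (fun n : ℕ => (l : ℝ) ^ n * (Nat.card (GModTrace (l ^ n) T) : ℝ)
          / (Nat.card (GMod (l ^ n)) : ℝ))
        atTop
        (𝓝 (((l : ℝ) ^ 6 - (l : ℝ) ^ 4 - 3 * (l : ℝ) ^ 3 + (l : ℝ))
              / ((l : ℝ) ^ 6 - 2 * (l : ℝ) ^ 4 + (l : ℝ) ^ 2)
            + ((EQuot l T : ℝ)
                + (l : ℝ) * (deltaDvd 2 (padicValInt l T) : ℝ) * ((l : ℝ) ^ 3 - 1))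
              / ((l : ℝ) ^ (4 * eFloor l T + 4) * ((l : ℝ) ^ 2 - 1) ^ 2)))
    ∧ ¬ (l ∣ (EQuot l T).den) := by
  have : Fact l.Prime := ⟨hl⟩
  have hl1 : (1 : ℚ) < l := by exact_mod_cast hl.one_lt
  have hl0 : (l : ℚ) ≠ 0 := by positivity
  have hm1 : (l : ℚ) - 1 ≠ 0 := by linarith
  have hp1 : (l : ℚ) + 1 ≠ 0 := by positivity
  have hs1 : (l : ℚ) ^ 2 + 1 ≠ 0 := by positivity
  have hsq : (l : ℚ) ^ 2 - 1 = (l - 1) * (l + 1) := by ring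
  have hcount : ∀ n : ℕ, padicValInt l T + 1 ≤ n →
      (Nat.card (GModTrace (l ^ n) T) : ℚ)
        = ((l : ℚ) - 1) * (l : ℚ) ^ (6 * (n : ℤ) - 4 * (eFloor l T : ℤ) - 9)
          * ((l : ℚ) ^ (4 * eFloor l T + 3)
                * ((l : ℚ) ^ 5 - (l : ℚ) ^ 3 - 3 * (l : ℚ) ^ 2 + 1)
              + EQuot l T
              + (l : ℚ) * (deltaDvd 2 (padicValInt l T) : ℚ) * ((l : ℚ) ^ 3 - 1)) := by
    intro n hn
    have hv1 : 1 ≤ padicValInt l T := by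
      have := (padicValInt_dvd_iff (p := l) 1 T).1 (by simpa using hlT)
      tauto
    rw [card_GModTrace_prime_pow hl2 hT hlT hn, EQuot]
    obtain ⟨m, rfl⟩ : ∃ m, n = m + 1 := ⟨n - 1, by omega⟩
    -- With n = m + 1 the exponent is 6m - (4e + 3), which may be negative; a quotient of natural
    -- powers suits `field_simp`.
    have hz : (l : ℚ) ^ (6 * ((m + 1 : ℕ) : ℤ) - 4 * (eFloor l T : ℤ) - 9)
        = (l : ℚ) ^ (6 * m) / (l : ℚ) ^ (4 * eFloor l T + 3) := by
      rw [← zpow_natCast, ← zpow_natCast, ← zpow_sub₀ hl0]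
      congr 1
      push_cast
      ring
    rw [hz, Nat.add_sub_cancel]
    set e := eFloor l T with he
    -- The truncated subtraction in e is harmless as the valuation is at least 1; the two parities
    -- are the two values of δ₂.
    have hv : padicValInt l T = 2 * e + 1 ∨ padicValInt l T = 2 * e + 2 := by
      rw [he, eFloor]; omega
    rcases hv with hv | hv
    · have hd : deltaDvd 2 (padicValInt l T) = 0 := by rw [deltaDvd, if_neg (by omega)]
      rw [hd, hv, hsq]
      field_simp
      ring
    · have hd : deltaDvd 2 (padicValInt l T) = 1 := by rw [deltaDvd, if_pos (by omega)]
      rw [hd, hv, hsq]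
      field_simp
      ring
  refine ⟨hcount, ?_, ?_⟩
  · have hlim : ∀ n : ℕ, padicValInt l T + 1 ≤ n →
        (l : ℚ) ^ n * (Nat.card (GModTrace (l ^ n) T) : ℚ) / (Nat.card (GMod (l ^ n)) : ℚ)
          = ((l : ℚ) ^ 6 - (l : ℚ) ^ 4 - 3 * (l : ℚ) ^ 3 + (l : ℚ))
              / ((l : ℚ) ^ 6 - 2 * (l : ℚ) ^ 4 + (l : ℚ) ^ 2)
            + (EQuot l T
                + (l : ℚ) * (deltaDvd 2 (padicValInt l T) : ℚ) * ((l : ℚ) ^ 3 - 1))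
              / ((l : ℚ) ^ (4 * eFloor l T + 4) * ((l : ℚ) ^ 2 - 1) ^ 2) := by
      intro n hn
      rw [hcount n hn]
      have hG := congrArg (Int.cast : ℤ → ℚ) (card_GMod_prime_pow (p := l) (n := n) (by omega))
      push_cast at hG
      obtain ⟨m, rfl⟩ : ∃ m, n = m + 1 := ⟨n - 1, by omega⟩
      have hz : (l : ℚ) ^ (6 * ((m + 1 : ℕ) : ℤ) - 4 * (eFloor l T : ℤ) - 9)
          = (l : ℚ) ^ (6 * m) / (l : ℚ) ^ (4 * eFloor l T + 3) := by
        rw [← zpow_natCast, ← zpow_natCast, ← zpow_sub₀ hl0]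
        congr 1
        push_cast
        ring
      have hden : (l : ℚ) ^ 6 - 2 * (l : ℚ) ^ 4 + (l : ℚ) ^ 2
          = (l : ℚ) ^ 2 * ((l - 1) * (l + 1)) ^ 2 := by ring
      rw [hG, hz, Nat.add_sub_cancel, hden, hsq]
      generalize EQuot l T = E
      generalize (deltaDvd 2 (padicValInt l T) : ℚ) = d
      field_simp
      ring
    refine tendsto_const_nhds.congr' ?_
    filter_upwards [eventually_ge_atTop (padicValInt l T + 1)] with n hn
    have := congrArg (Rat.cast : ℚ → ℝ) (hlim n hn)
    push_cast at this
    exact this.symm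
  -- Both factors are 1 mod ℓ, so no divisor of the product is a multiple of ℓ.
  · have hdvd : (EQuot l T).den ∣ (l ^ 2 + 1) * (l + 1) := by
      have h := Rat.den_dvd
        (2 * (l : ℤ) ^ 3 * ((l : ℤ) + 1) * ((l : ℤ) ^ (4 * eFloor l T + 4) - 1)
          + (l : ℤ) ^ 3 * ((l : ℤ) ^ 4 + (l : ℤ) ^ 3 + 2 * (l : ℤ) ^ 2 - (l : ℤ) - 1)
            * ((l : ℤ) ^ (4 * eFloor l T) - 1)) (((l ^ 2 + 1) * (l + 1) : ℕ) : ℤ)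
      rw [Int.natCast_dvd_natCast, Rat.divInt_eq_div] at h
      rw [EQuot]
      exact_mod_cast h
    intro h
    have h1 := h.trans hdvd
    rcases (hl.dvd_mul).1 h1 with h2 | h2
    · exact hl.one_lt.ne' (Nat.dvd_one.1 ((Nat.dvd_add_right (dvd_pow_self l two_ne_zero)).1 h2))
    · exact hl.one_lt.ne' (Nat.dvd_one.1 ((Nat.dvd_add_right dvd_rfl).1 h2))
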